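/- Theorem (constant coefficients with polynomial forcing). Let $\mathbb T\subseteq\mathbb R$ be a time scale (a nonempty closed set) with forward jump $\sigma$ and graininess $\mu(t)=\sigma(t)-t$, let $a\in\mathbb T$, $k\in\mathbb Z_{\ge 0}$, $\gamma_0,\dots,\gamma_k\in\mathbb R$, and let $\alpha,\beta\in\mathbb R$ satisfy $\beta\neq 0$, $\beta\neq\alpha^2$ and $1-2\alpha\mu(t)+\beta\mu(t)^2\neq 0$ for all $t\in\mathbb T$. Let $h_0(t,a)=1$ and $h_{j+1}(t,a)=\int_a^t h_j(\tau,a)\,\Delta\tau$ be the time-scale polynomials, let $e_\lambda(t,a)=\exp\int_a^t\xi_{\mu(\tau)}(\lambda)\,\Delta\tau$ be the time-scale exponential of a constant $\lambda$ (here $\xi_h(z)=\frac1h\operatorname{Log}(1+zh)$ for $h>0$ and $\xi_0(z)=z$), let $\sqrt{\alpha^2-\beta}$ be the principal square root, and put $\lambda_1=-\alpha-\sqrt{\alpha^2-\beta}$, $\lambda_2=-\alpha+\sqrt{\alpha^2-\beta}$. Let $\mathbb T^\kappa$ be $\mathbb T$ without its maximum if this exists and is left-scattered, and $\mathbb T^\kappa=\mathbb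 T$ otherwise; let $\mathbb T^{\kappa^2}=(\mathbb T^\kappa)^\kappa$. Then a function $y:\mathbb T\to\mathbb C$ is a solution of $$y^{\Delta\Delta}+2\alpha y^{\Delta}+\beta y=\sum_{i=0}^k\gamma_i h_i(\cdot,a)\qquad\text{on }\mathbb T^{\kappa^2}$$ (that is, $y$ has a delta derivative $y^\Delta$ on $\mathbb T^\kappa$, the function $y^\Delta:\mathbb T^\kappa\to\mathbb C$ has a delta derivative $y^{\Delta\Delta}$ on $\mathbb T^{\kappa^2}$, and the equation holds there) if and only if there are $c_1,c_2\in\mathbb C$ with $$y(t)=c_1e_{\lambda_1}(t,a)+c_2e_{\lambda_2}(t,a)+\sum_{i=0}^k\xi_ih_i(t,a)\qquad\text{for all }t\in\mathbb T .$$ If $\beta<\alpha^2$, then the same holds for real-valued $y$ with $c_1,c_2\in\mathbb R$. Here $\xi_k=\frac1\beta\gamma_k$; if $k\ge1$, $\xi_{k-1}=\frac1\beta\bigl(\gamma_{k-1}-\frac{2\alpha}{\beta}\gamma_k\bigr)$; and if $k\ge 2$, for $0\le i\le k-2$, $$\xi_i=\omega_1\lambda_1^i+\omega_2\lambda_2^i+S_i,\qquad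 S_i=\sum_{\tau=0}^{i-1}\sum_{s=0}^{\tau-1}\gamma_s\lambda_1^{\,i+s-2\tau}\beta^{\,\tau-1-s},$$ $$\begin{bmatrix}\omega_1\\ \omega_2\end{bmatrix}=\frac{1}{2\beta^{k-1}\sqrt{\alpha^2-\beta}}\begin{bmatrix}\lambda_2^k&-\lambda_2^{k-1}\\-\lambda_1^k&\lambda_1^{k-1}\end{bmatrix}\begin{bmatrix}\xi_{k-1}-S_{k-1}\\ \xi_k-S_k\end{bmatrix}.$$ Moreover all $\xi_i$ are real, and $\xi_{i+2}+2\alpha\xi_{i+1}+\beta\xi_i=\gamma_i$ for $0\le i\le k-2$. -/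

import Mathlib

open MeasureTheory Set

noncomputable section

namespace TimeScale

/-! A time scale is a nonempty closed subset `T` of `ℝ`. Functions on `T` are represented by
functions on `ℝ`; all notions below that involve points of `T` only use the values on `T`. -/

/-- Forward jump operator `σ(t) = inf {s ∈ T | s > t}`, with `σ(t) = t` at a maximum of `T`. -/
def sigma (T : Set ℝ) (t : ℝ) : ℝ :=
  open Classical in if (T ∩ Ioi t).Nonempty then sInf (T ∩ Ioi t) else t

/-- Backward jump operator `ρ(t) = sup {s ∈ T | s < t}`, with `ρ(t) = t` at a minimum of `T`. -/
def rho (T : Set ℝ) (t : ℝ) : ℝ :=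
  open Classical in if (T ∩ Iio t).Nonempty then sSup (T ∩ Iio t) else t

/-- Graininess `μ(t) = σ(t) - t`. -/
def mu (T : Set ℝ) (t : ℝ) : ℝ := sigma T t - t

/-- `T^κ`: the set `T` with its maximum removed if that maximum exists and is left-scattered. -/
def kappa (T : Set ℝ) : Set ℝ := {t | t ∈ T ∧ ¬ (IsGreatest T t ∧ rho T t < t)}

/-- `f` has (Hilger) delta derivative `f'` at `t`, with respect to the time scale `T`. -/
def HasDeltaDeriv (T : Set ℝ) (f : ℝ → ℂ) (f' : ℂ) (t : ℝ) : Prop :=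
  ∀ ε > 0, ∃ δ > 0, ∀ s ∈ T, |s - t| < δ →
    ‖f (sigma T t) - f s - f' * ((sigma T t - s : ℝ) : ℂ)‖ ≤ ε * |sigma T t - s|

/-- The largest point of `T` not exceeding `s` (for closed `T` having such points). -/
def floorPt (T : Set ℝ) (s : ℝ) : ℝ := sSup (T ∩ Iic s)

/-- The real numbers `s` with `t₀ ≤ s < t₁` for some `t₀, t₁ ∈ T`. -/
def span (T : Set ℝ) : Set ℝ := {s | (T ∩ Iic s).Nonempty ∧ (T ∩ Ioi s).Nonempty}

/-- The Lebesgue delta measure of `T`: the measure carried by `T` that gives `[c, d) ∩ T` the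
mass `d - c` for `c ≤ d` in `T` (see `deltaMeasure_Ico` and `deltaMeasure_compl`). It is Lebesgue
measure, with the gap `[t, σ(t))` swept to `t` for every right-scattered `t`. -/
def deltaMeasure (T : Set ℝ) : Measure ℝ := (volume.restrict (span T)).map (floorPt T)

theorem floorPt_mem {T : Set ℝ} (hT : IsClosed T) {s : ℝ} (hs : (T ∩ Iic s).Nonempty) :
    floorPt T s ∈ T ∩ Iic s :=
  (hT.inter isClosed_Iic).csSup_mem hs ⟨s, fun _ hx => hx.2⟩

theorem monotoneOn_floorPt (T : Set ℝ) : MonotoneOn (floorPt T) (span T) := by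
  intro x hx y _ hxy
  exact csSup_le_csSup ⟨y, fun _ h => h.2⟩ hx.1 fun z hz => ⟨hz.1, le_trans hz.2 hxy⟩

theorem measurableSet_span (T : Set ℝ) : MeasurableSet (span T) := by
  have : OrdConnected (span T) := by
    refine ⟨fun x hx y hy z hz => ⟨?_, ?_⟩⟩
    · obtain ⟨u, hu⟩ := hx.1
      exact ⟨u, hu.1, le_trans hu.2 hz.1⟩
    · obtain ⟨u, hu⟩ := hy.2
      exact ⟨u, hu.1, lt_of_le_of_lt hz.2 hu.2⟩
  exact this.measurableSet

theorem aemeasurable_floorPt (T : Set ℝ) : AEMeasurable (floorPt T) (volume.restrict (span T)) :=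
  aemeasurable_restrict_of_monotoneOn (measurableSet_span T) (monotoneOn_floorPt T)

theorem deltaMeasure_compl {T : Set ℝ} (hT : IsClosed T) : deltaMeasure T Tᶜ = 0 := by
  rw [deltaMeasure, Measure.map_apply_of_aemeasurable (aemeasurable_floorPt T)
    hT.measurableSet.compl, Measure.restrict_apply' (measurableSet_span T)]
  convert measure_empty (μ := (volume : Measure ℝ))
  ext s
  simp only [mem_inter_iff, mem_preimage, mem_compl_iff, mem_empty_iff_false, iff_false, not_and]
  exact fun h hs => h (floorPt_mem hT hs.1).1

theorem deltaMeasure_Ico {T : Set ℝ} (hT : IsClosed T) {c d : ℝ} (hc : c ∈ T) (hd : d ∈ T) :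
    deltaMeasure T (Ico c d) = ENNReal.ofReal (d - c) := by
  rw [deltaMeasure, Measure.map_apply_of_aemeasurable (aemeasurable_floorPt T) measurableSet_Ico,
    Measure.restrict_apply' (measurableSet_span T), ← Real.volume_Ico]
  congr 1
  ext s
  simp only [mem_inter_iff, mem_preimage, mem_Ico]
  constructor
  · rintro ⟨⟨h1, h2⟩, hs⟩
    refine ⟨h1.trans (floorPt_mem hT hs.1).2, ?_⟩
    by_contra! h
    exact absurd (le_csSup ⟨s, fun _ hx => hx.2⟩ ⟨hd, h⟩ : d ≤ floorPt T s) (not_le.2 h2)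
  · rintro ⟨h1, h2⟩
    have hs : (T ∩ Iic s).Nonempty := ⟨c, hc, h1⟩
    exact ⟨⟨le_csSup ⟨s, fun _ hx => hx.2⟩ ⟨hc, h1⟩, lt_of_le_of_lt (floorPt_mem hT hs).2 h2⟩,
      hs, ⟨d, hd, h2⟩⟩

/-- The delta integral `∫_a^t f(τ) Δτ` for `a, t ∈ T`. -/
def deltaIntegral {E : Type*} [NormedAddCommGroup E] [NormedSpace ℝ E] (T : Set ℝ) (f : ℝ → E)
    (a t : ℝ) : E :=
  if a ≤ t then ∫ τ in Ico a t, f τ ∂(deltaMeasure T) else -∫ τ in Ico t a, f τ ∂(deltaMeasure T)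

/-- The time-scale polynomials: `h_0(t,a) = 1`, `h_{k+1}(t,a) = ∫_a^t h_k(τ,a) Δτ`. -/
def hPoly (T : Set ℝ) (a : ℝ) : ℕ → ℝ → ℝ
  | 0 => fun _ => 1
  | k + 1 => fun t => deltaIntegral T (hPoly T a k) a t

/-- Cylinder transformation: `Log(1 + z h) / h` for `h ≠ 0` and `z` for `h = 0`. -/
def cylinder (h : ℝ) (z : ℂ) : ℂ := if h = 0 then z else Complex.log (1 + z * h) / h

/-- The time-scale exponential `e_z(t,a)` for a constant `z`. -/
def tsExp (T : Set ℝ) (z : ℂ) (t a : ℝ) : ℂ :=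
  Complex.exp (deltaIntegral T (fun τ => cylinder (mu T τ) z) a t)

/-- `y` solves `y^{ΔΔ} + 2 α y^Δ + β y = f` on `T`: there are a delta derivative `y₁` of `y` on
`T^κ` and a delta derivative `y₂` of `y₁ : T^κ → ℂ` on `(T^κ)^κ`, and the equation holds on
`(T^κ)^κ`. -/
def IsSolution (T : Set ℝ) (α β : ℝ) (f y : ℝ → ℂ) : Prop :=
  ∃ y₁ y₂ : ℝ → ℂ,
    (∀ t ∈ kappa T, HasDeltaDeriv T y (y₁ t) t) ∧
    (∀ t ∈ kappa (kappa T), HasDeltaDeriv (kappa T) y₁ (y₂ t) t) ∧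
    ∀ t ∈ kappa (kappa T), y₂ t + 2 * α * y₁ t + β * y t = f t

/-- The principal square root of `α² - β`, a complex number. -/
def root (α β : ℝ) : ℂ := ((α : ℂ) ^ 2 - β) ^ (1 / 2 : ℂ)

/-- `λ₁ = -α - √(α² - β)`. -/
def lam1 (α β : ℝ) : ℂ := -α - root α β

/-- `λ₂ = -α + √(α² - β)`. -/
def lam2 (α β : ℝ) : ℂ := -α + root α β

/-- `∑_{τ=0}^{i-1} ∑_{s=0}^{τ-1} γ_s λ₁^{i+s-2τ} β^{τ-1-s}`. -/
def dblSum (α β : ℝ) (γ : ℕ → ℝ) (i : ℕ) : ℂ :=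
  ∑ τ ∈ Finset.range i, ∑ s ∈ Finset.range τ,
    (γ s : ℂ) * lam1 α β ^ ((i : ℤ) + s - 2 * τ) * (β : ℂ) ^ ((τ : ℤ) - 1 - s)

/-- The terminal value `ξ_k = γ_k / β`. -/
def xiLast (β : ℝ) (γ : ℕ → ℝ) (k : ℕ) : ℂ := 1 / (β : ℂ) * γ k

/-- The terminal value `ξ_{k-1} = (γ_{k-1} - 2 α γ_k / β) / β`, for `k ≥ 1`. -/
def xiPrev (α β : ℝ) (γ : ℕ → ℝ) (k : ℕ) : ℂ :=
  1 / (β : ℂ) * (γ (k - 1) - 2 * α / β * γ k)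

/-- The vector `(ω₁, ω₂)`, for `k ≥ 2`. -/
def omega (α β : ℝ) (γ : ℕ → ℝ) (k : ℕ) : Fin 2 → ℂ :=
  (1 / (2 * (β : ℂ) ^ (k - 1) * root α β)) •
    (Matrix.mulVec !![lam2 α β ^ k, -lam2 α β ^ (k - 1); -lam1 α β ^ k, lam1 α β ^ (k - 1)]
      ![xiPrev α β γ k - dblSum α β γ (k - 1), xiLast β γ k - dblSum α β γ k])

/-- The coefficients `ξ_i`, `0 ≤ i ≤ k`. -/
def xi (α β : ℝ) (γ : ℕ → ℝ) (k i : ℕ) : ℂ :=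
  if i = k then xiLast β γ k
  else if i + 1 = k then xiPrev α β γ k
  else omega α β γ k 0 * lam1 α β ^ i + omega α β γ k 1 * lam2 α β ^ i + dblSum α β γ i

end TimeScale

end

/-!
Why the theorem is true. On a time scale `T`, a delta derivative at `t` is an ordinary derivative
within `T` if `t` is right-dense, and is continuity at `t` together with a value of the difference
quotient from `t` to `σ(t)` if `t` is right-scattered (`hasDeltaDeriv_iff_of_sigma_eq`,
`hasDeltaDeriv_iff_of_lt_sigma`).

*Existence.* The graininess tends to `0` along `T \ {t}` at every `t ∈ T` (`tendsto_mu`), so the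
cylinder transform of a constant `z` has the limit `z` at every punctured point of `T`. Hence it is
integrable on bounded parts of `T`, its integral has the derivative `z` within `T`, and the
exponential solves `x^Δ = z x` (`hasDeltaDeriv_tsExp`). The regressivity condition factors as
`(1 + λ₁ μ) (1 + λ₂ μ) ≠ 0`, so this applies to both characteristic roots. Delta differentiation
shifts the coefficients of a time-scale polynomial, so `∑ ξ_i h_i` is a particular solution as soon
as `ξ_{i+2} + 2 α ξ_{i+1} + β ξ_i = γ_i` for `0 ≤ i ≤ k`, with `ξ_{k+1} = ξ_{k+2} = 0`. The double
sum `S` solves this recursion, and `ω₁`, `ω₂` adjust it to the terminal values (`dblSum_add_two`,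
`xi_eq`).

*Uniqueness.* A mean value inequality (`norm_sub_le_of_norm_deltaDeriv_le`) shows that a function
with zero delta derivative is constant. Dividing by the exponential, solutions of a first-order
equation are multiples of the exponential. For the second-order equation the operator factors: for
a homogeneous solution `d`, the function `d^Δ - λ₁ d` solves the first-order equation for `λ₂`, and
then `d` itself is found from a first-order equation for `λ₁`, as `λ₁ ≠ λ₂`
(`exists_eq_add_of_isSolution`). No initial value at `a` is used, which matters because `a` may be
a left-scattered maximum of `T`, where `d^Δ` is not defined.

The first of these two equations lives on the time scale `T^κ`, whose forward jump at its maximum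
differs from that of `T`; `hasDeltaDeriv_kappa` moves delta derivatives from `T` to `T^κ`.
-/

namespace TimeScale

open Filter Topology

variable {T : Set ℝ} {t : ℝ}

/-! ### The jump operator and the graininess -/

theorem le_sigma (T : Set ℝ) (t : ℝ) : t ≤ sigma T t := by
  unfold sigma
  split_ifs with h
  · exact le_csInf h fun x hx => le_of_lt hx.2
  · exact le_rfl

theorem sigma_le {s : ℝ} (hs : s ∈ T) (hts : t < s) : sigma T t ≤ s := by
  have h : (T ∩ Ioi t).Nonempty := ⟨s, hs, hts⟩
  rw [sigma, if_pos h]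
  exact csInf_le ⟨t, fun x hx => le_of_lt hx.2⟩ ⟨hs, hts⟩

theorem le_of_lt_sigma {s : ℝ} (hs : s ∈ T) (h : s < sigma T t) : s ≤ t := by
  by_contra! hts
  exact absurd (sigma_le hs hts) (not_le.2 h)

theorem sigma_mem (hT : IsClosed T) (ht : t ∈ T) : sigma T t ∈ T := by
  unfold sigma
  split_ifs with h
  · exact closure_minimal inter_subset_left hT
      (csInf_mem_closure h ⟨t, fun x hx => le_of_lt hx.2⟩)
  · exact ht

theorem sigma_eq_self_of_inter_Ioi_eq_empty (h : ¬ (T ∩ Ioi t).Nonempty) : sigma T t = t := by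
  rw [sigma, if_neg h]

theorem monotone_sigma (T : Set ℝ) : Monotone (sigma T) := by
  intro x y hxy
  rcases hxy.eq_or_lt with rfl | hlt
  · exact le_rfl
  by_cases hy : (T ∩ Ioi y).Nonempty
  · have hsub : T ∩ Ioi y ⊆ T ∩ Ioi x := inter_subset_inter_right _ (Ioi_subset_Ioi hxy)
    rw [sigma, sigma, if_pos hy, if_pos (hy.mono hsub)]
    exact csInf_le_csInf ⟨x, fun z hz => le_of_lt hz.2⟩ hy hsub
  · rw [sigma_eq_self_of_inter_Ioi_eq_empty hy]
    by_cases hx : (T ∩ Ioi x).Nonempty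
    · obtain ⟨z, hz⟩ := hx
      have hzy : z ≤ y := by
        by_contra! h
        exact hy ⟨z, hz.1, h⟩
      exact (sigma_le hz.1 hz.2).trans hzy
    · rw [sigma_eq_self_of_inter_Ioi_eq_empty hx]
      exact hxy

theorem mu_nonneg (T : Set ℝ) (t : ℝ) : 0 ≤ mu T t := sub_nonneg.2 (le_sigma T t)

theorem measurable_mu (T : Set ℝ) : Measurable (mu T) :=
  (monotone_sigma T).measurable.sub measurable_id

/-- Off `t` itself, the graininess tends to `0` at every point `t`: points of `T` to the left of
`t` jump at most to `t`, and to the right of `t` there are either no nearby points or arbitrarily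
close ones. Thus `μ` can be discontinuous at `t` only through its value there. -/
theorem tendsto_mu (ht : t ∈ T) : Tendsto (mu T) (𝓝[T \ {t}] t) (𝓝 0) := by
  rw [Metric.tendsto_nhdsWithin_nhds]
  intro ε hε
  suffices h : ∃ δ > 0, ∀ x ∈ T, x ≠ t → |x - t| < δ → mu T x < ε by
    obtain ⟨δ, hδ, h⟩ := h
    refine ⟨δ, hδ, fun x hx hxt => ?_⟩
    rw [Real.dist_eq, sub_zero, abs_of_nonneg (mu_nonneg T x)]
    exact h x hx.1 hx.2 hxt
  have left : ∀ x, x < t → |x - t| < ε → mu T x < ε := by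
    intro x hx h
    rw [abs_sub_comm, abs_of_pos (sub_pos.2 hx)] at h
    exact (sub_le_sub_right (sigma_le ht hx) x).trans_lt h
  by_cases hs : ∃ s ∈ T, t < s ∧ s < t + ε
  · obtain ⟨s, hsT, hts, hsε⟩ := hs
    refine ⟨min ε (s - t), lt_min hε (sub_pos.2 hts), fun x _ hxt h => ?_⟩
    rcases lt_or_gt_of_ne hxt with hlt | hgt
    · exact left x hlt (h.trans_le (min_le_left _ _))
    · have h2 := (abs_lt.1 (h.trans_le (min_le_right _ _))).2
      have := sigma_le hsT (show x < s by linarith)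
      unfold mu
      linarith
  · push Not at hs
    refine ⟨ε, hε, fun x hxT hxt h => ?_⟩
    rcases lt_or_gt_of_ne hxt with hlt | hgt
    · exact left x hlt h
    · have h1 := hs x hxT hgt
      have h2 := (abs_lt.1 h).2
      linarith

/-! ### The delta derivative -/

theorem hasDeltaDeriv_iff_of_sigma_eq {f : ℝ → ℂ} {f' : ℂ} (h : sigma T t = t) :
    HasDeltaDeriv T f f' t ↔ HasDerivWithinAt f f' T t := by
  rw [hasDerivWithinAt_iff_isLittleO, Asymptotics.isLittleO_iff]
  have key : ∀ s, f t - f s - f' * ((t - s : ℝ) : ℂ) = -(f s - f t - (s - t) • f') := by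
    intro s
    rw [Complex.real_smul]
    push_cast
    ring
  simp only [HasDeltaDeriv, h, key, norm_neg, Metric.eventually_nhds_iff, eventually_nhdsWithin_iff,
    Real.dist_eq, Real.norm_eq_abs, abs_sub_comm t]
  constructor
  · intro H c hc
    obtain ⟨δ, hδ, H⟩ := H c hc
    exact ⟨δ, hδ, fun s hs hsT => H s hsT hs⟩
  · intro H c hc
    obtain ⟨δ, hδ, H⟩ := H hc
    exact ⟨δ, hδ, fun s hsT hs => H hs hsT⟩

theorem HasDeltaDeriv.sub_eq {f : ℝ → ℂ} {f' : ℂ} (ht : t ∈ T) (h : HasDeltaDeriv T f f' t) :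
    f (sigma T t) - f t = f' * (mu T t : ℂ) := by
  rw [← sub_eq_zero, ← norm_le_zero_iff]
  have H : ∀ ε > 0, ‖f (sigma T t) - f t - f' * (mu T t : ℂ)‖ ≤ ε * |mu T t| := by
    intro ε hε
    obtain ⟨δ, hδ, h⟩ := h ε hε
    exact h t ht (by simpa using hδ)
  have hlim : Tendsto (fun ε : ℝ => ε * |mu T t|) (𝓝[>] 0) (𝓝 0) := by
    have : Continuous fun ε : ℝ => ε * |mu T t| := by fun_prop
    simpa using (this.tendsto 0).mono_left nhdsWithin_le_nhds
  exact ge_of_tendsto hlim (eventually_mem_nhdsWithin.mono H)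

theorem hasDeltaDeriv_iff_of_lt_sigma {f : ℝ → ℂ} {f' : ℂ} (ht : t ∈ T) (h : t < sigma T t) :
    HasDeltaDeriv T f f' t ↔
      ContinuousWithinAt f T t ∧ f (sigma T t) - f t = f' * (mu T t : ℂ) := by
  have hmu : 0 < mu T t := sub_pos.2 h
  have key : f (sigma T t) - f t = f' * (mu T t : ℂ) → ∀ s,
      f (sigma T t) - f s - f' * ((sigma T t - s : ℝ) : ℂ)
        = (f t - f' * (t : ℂ)) - (f s - f' * (s : ℂ)) := by
    intro he s
    unfold mu at he
    push_cast at he ⊢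
    linear_combination he
  -- subtracting a linear function does not affect continuity
  have hcont : ContinuousWithinAt f T t ↔ ContinuousWithinAt (fun s => f s - f' * (s : ℂ)) T t := by
    have hl : ContinuousWithinAt (fun s : ℝ => f' * (s : ℂ)) T t := by fun_prop
    refine ⟨fun hf => hf.sub hl, fun hf => ?_⟩
    exact (hf.add hl).congr (fun s _ => (sub_add_cancel _ _).symm) (sub_add_cancel _ _).symm
  constructor
  · intro H
    have he := H.sub_eq ht
    refine ⟨hcont.2 ?_, he⟩
    rw [Metric.continuousWithinAt_iff]
    intro ε hε
    obtain ⟨δ, hδ, H⟩ := H (ε / (2 * (mu T t + 1))) (by positivity)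
    refine ⟨min δ 1, lt_min hδ one_pos, fun {s} hs hst => ?_⟩
    rw [Real.dist_eq] at hst
    have h1 := H s hs (hst.trans_le (min_le_left _ _))
    rw [key he] at h1
    rw [dist_comm, dist_eq_norm]
    refine h1.trans_lt ?_
    have h2 := abs_lt.1 (hst.trans_le (min_le_right _ _))
    have h3 : |sigma T t - s| ≤ mu T t + 1 := by
      unfold mu at *
      rw [abs_le]
      constructor <;> linarith
    calc ε / (2 * (mu T t + 1)) * |sigma T t - s|
        ≤ ε / (2 * (mu T t + 1)) * (mu T t + 1) := by gcongr
      _ = ε / 2 := by field_simp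
      _ < ε := by linarith
  · rintro ⟨hc, he⟩ ε hε
    rw [hcont, Metric.continuousWithinAt_iff] at hc
    obtain ⟨δ, hδ, hc⟩ := hc (ε * (mu T t / 2)) (by positivity)
    refine ⟨min δ (mu T t / 2), lt_min hδ (by positivity), fun s hs hst => ?_⟩
    have h1 := hc hs (by rw [Real.dist_eq]; exact hst.trans_le (min_le_left _ _))
    rw [dist_comm, dist_eq_norm] at h1
    rw [key he]
    refine h1.le.trans ?_
    gcongr
    have h2 := abs_lt.1 (hst.trans_le (min_le_right _ _))
    refine le_trans ?_ (le_abs_self _)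
    unfold mu at *
    linarith

theorem HasDeltaDeriv.continuousWithinAt {f : ℝ → ℂ} {f' : ℂ} (ht : t ∈ T)
    (h : HasDeltaDeriv T f f' t) : ContinuousWithinAt f T t := by
  rcases (le_sigma T t).eq_or_lt with he | hlt
  · exact ((hasDeltaDeriv_iff_of_sigma_eq he.symm).1 h).continuousWithinAt
  · exact ((hasDeltaDeriv_iff_of_lt_sigma ht hlt).1 h).1

theorem HasDeltaDeriv.congr {f g : ℝ → ℂ} {f' : ℂ} (hT : IsClosed T) (ht : t ∈ T)
    (h : HasDeltaDeriv T f f' t) (hfg : ∀ s ∈ T, g s = f s) : HasDeltaDeriv T g f' t := by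
  intro ε hε
  obtain ⟨δ, hδ, h⟩ := h ε hε
  refine ⟨δ, hδ, fun s hs hst => ?_⟩
  rw [hfg s hs, hfg _ (sigma_mem hT ht)]
  exact h s hs hst

theorem hasDeltaDeriv_id (T : Set ℝ) (t : ℝ) : HasDeltaDeriv T (fun s => (s : ℂ)) 1 t := by
  intro ε hε
  refine ⟨1, one_pos, fun s _ _ => ?_⟩
  push_cast
  rw [one_mul, sub_self, norm_zero]
  positivity

theorem hasDeltaDeriv_const (T : Set ℝ) (t : ℝ) (c : ℂ) : HasDeltaDeriv T (fun _ => c) 0 t := by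
  intro ε hε
  refine ⟨1, one_pos, fun s _ _ => ?_⟩
  simp only [sub_self, zero_mul, norm_zero]
  positivity

theorem HasDeltaDeriv.add {f g : ℝ → ℂ} {f' g' : ℂ} (hf : HasDeltaDeriv T f f' t)
    (hg : HasDeltaDeriv T g g' t) : HasDeltaDeriv T (fun s => f s + g s) (f' + g') t := by
  intro ε hε
  obtain ⟨δ₁, hδ₁, h₁⟩ := hf (ε / 2) (half_pos hε)
  obtain ⟨δ₂, hδ₂, h₂⟩ := hg (ε / 2) (half_pos hε)
  refine ⟨min δ₁ δ₂, lt_min hδ₁ hδ₂, fun s hs hst => ?_⟩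
  have e : f (sigma T t) + g (sigma T t) - (f s + g s) - (f' + g') * ((sigma T t - s : ℝ) : ℂ)
      = (f (sigma T t) - f s - f' * ((sigma T t - s : ℝ) : ℂ))
        + (g (sigma T t) - g s - g' * ((sigma T t - s : ℝ) : ℂ)) := by ring
  rw [e]
  refine (norm_add_le _ _).trans ?_
  have h1 := h₁ s hs (hst.trans_le (min_le_left _ _))
  have h2 := h₂ s hs (hst.trans_le (min_le_right _ _))
  linarith

theorem HasDeltaDeriv.const_mul {f : ℝ → ℂ} {f' : ℂ} (c : ℂ) (hf : HasDeltaDeriv T f f' t) :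
    HasDeltaDeriv T (fun s => c * f s) (c * f') t := by
  intro ε hε
  obtain ⟨δ, hδ, h⟩ := hf (ε / (‖c‖ + 1)) (by positivity)
  refine ⟨δ, hδ, fun s hs hst => ?_⟩
  have e : c * f (sigma T t) - c * f s - c * f' * ((sigma T t - s : ℝ) : ℂ)
      = c * (f (sigma T t) - f s - f' * ((sigma T t - s : ℝ) : ℂ)) := by ring
  rw [e, norm_mul]
  calc ‖c‖ * ‖f (sigma T t) - f s - f' * ((sigma T t - s : ℝ) : ℂ)‖
      ≤ (‖c‖ + 1) * (ε / (‖c‖ + 1) * |sigma T t - s|) := by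
        gcongr
        · linarith
        · exact h s hs hst
    _ = ε * |sigma T t - s| := by field_simp

theorem HasDeltaDeriv.sub {f g : ℝ → ℂ} {f' g' : ℂ} (hf : HasDeltaDeriv T f f' t)
    (hg : HasDeltaDeriv T g g' t) : HasDeltaDeriv T (fun s => f s - g s) (f' - g') t := by
  simpa only [neg_one_mul, ← sub_eq_add_neg] using hf.add (hg.const_mul (-1))

theorem HasDeltaDeriv.sum {ι : Type*} (u : Finset ι) {f : ι → ℝ → ℂ} {f' : ι → ℂ}
    (h : ∀ i ∈ u, HasDeltaDeriv T (f i) (f' i) t) :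
    HasDeltaDeriv T (fun s => ∑ i ∈ u, f i s) (∑ i ∈ u, f' i) t := by
  classical
  induction u using Finset.induction_on with
  | empty => simpa using hasDeltaDeriv_const T t 0
  | insert i u hi ih =>
    simp only [Finset.sum_insert hi]
    exact (h i (Finset.mem_insert_self i u)).add
      (ih fun j hj => h j (Finset.mem_insert_of_mem hj))

theorem HasDeltaDeriv.conj {f : ℝ → ℂ} {f' : ℂ} (hf : HasDeltaDeriv T f f' t) :
    HasDeltaDeriv T (fun s => starRingEnd ℂ (f s)) (starRingEnd ℂ f') t := by
  intro ε hε
  obtain ⟨δ, hδ, h⟩ := hf ε hε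
  refine ⟨δ, hδ, fun s hs hst => ?_⟩
  have e : starRingEnd ℂ (f (sigma T t)) - starRingEnd ℂ (f s)
      - starRingEnd ℂ f' * ((sigma T t - s : ℝ) : ℂ)
      = starRingEnd ℂ (f (sigma T t) - f s - f' * ((sigma T t - s : ℝ) : ℂ)) := by
    simp only [map_sub, map_mul, Complex.conj_ofReal]
  rw [e, RCLike.norm_conj]
  exact h s hs hst

/-- If `f` and `g` satisfy the same linear equation `x^Δ = z x` at `t` and `g` has no zeros, then
`(f / g)^Δ = 0` at `t`. -/
theorem HasDeltaDeriv.div_eq_zero {f g : ℝ → ℂ} {z : ℂ} (ht : t ∈ T)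
    (hf : HasDeltaDeriv T f (z * f t) t) (hg : HasDeltaDeriv T g (z * g t) t)
    (hg0 : ∀ s, g s ≠ 0) : HasDeltaDeriv T (fun s => f s / g s) 0 t := by
  rcases (le_sigma T t).eq_or_lt with he | hlt
  · rw [hasDeltaDeriv_iff_of_sigma_eq he.symm] at *
    exact (hf.div hg (hg0 t)).congr_deriv
      (by rw [sub_eq_zero.2 (show z * f t * g t = f t * (z * g t) by ring), zero_div])
  · refine (hasDeltaDeriv_iff_of_lt_sigma ht hlt).2
      ⟨(hf.continuousWithinAt ht).div (hg.continuousWithinAt ht) (hg0 t), ?_⟩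
    have h1 := hf.sub_eq ht
    have h2 := hg.sub_eq ht
    rw [zero_mul, sub_eq_zero, div_eq_div_iff (hg0 _) (hg0 _)]
    linear_combination g t * h1 - f t * h2

/-! ### The mean value inequality -/

/-- Mean value inequality. The points of `T ∩ [r, s]` at which a slightly weaker bound holds form
a compact set, and the delta derivative rules out that its greatest element is less than `s`. -/
theorem norm_sub_le_of_norm_deltaDeriv_le (hT : IsClosed T) {f f' : ℝ → ℂ} {r s C : ℝ}
    (hr : r ∈ T) (hs : s ∈ T) (hrs : r ≤ s)
    (hd : ∀ t ∈ T, r ≤ t → t < s → HasDeltaDeriv T f (f' t) t)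
    (hC : ∀ t ∈ T, r ≤ t → t < s → ‖f' t‖ ≤ C) (hc : ContinuousWithinAt f T s) :
    ‖f s - f r‖ ≤ C * (s - r) := by
  have key : ∀ η > 0, ‖f s - f r‖ ≤ (C + η) * (s - r) := by
    intro η hη
    have hcont : ContinuousOn f (T ∩ Icc r s) := by
      rintro t ⟨htT, hrt, hts⟩
      refine ContinuousWithinAt.mono ?_ inter_subset_left
      rcases hts.eq_or_lt with rfl | hlt
      · exact hc
      · exact (hd t htT hrt hlt).continuousWithinAt htT
    have hcl : IsClosed (T ∩ Icc r s) := hT.inter isClosed_Icc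
    have hA : IsCompact {t ∈ T ∩ Icc r s | ‖f t - f r‖ ≤ (C + η) * (t - r)} :=
      (isCompact_Icc (a := r) (b := s)).of_isClosed_subset
        (hcl.isClosed_le (hcont.sub continuousOn_const).norm (by fun_prop)) fun t ht => ht.1.2
    obtain ⟨t, ⟨⟨⟨htT, hrt, hts⟩, hb⟩, hmax⟩⟩ :=
      hA.exists_isGreatest ⟨r, ⟨hr, le_rfl, hrs⟩, by simp⟩
    rcases hts.eq_or_lt with rfl | hlt
    · exact hb
    exfalso
    have hD := hd t htT hrt hlt
    have hCt := hC t htT hrt hlt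
    obtain ⟨u, huT, htu, hus, hu⟩ :
        ∃ u ∈ T, t < u ∧ u ≤ s ∧ ‖f u - f t‖ ≤ (C + η) * (u - t) := by
      rcases (le_sigma T t).eq_or_lt with he | hjump
      · obtain ⟨δ, hδ, H⟩ := hD η hη
        have hne : (T ∩ Ioi t).Nonempty := ⟨s, hs, hlt⟩
        have hinf : sInf (T ∩ Ioi t) < min s (t + δ) := by
          rw [sigma, if_pos hne] at he
          rw [← he]
          exact lt_min hlt (by linarith)
        obtain ⟨u, ⟨huT, htu⟩, hu⟩ := exists_lt_of_csInf_lt hne hinf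
        rw [mem_Ioi] at htu
        have hus := hu.trans_le (min_le_left _ _)
        have huδ := hu.trans_le (min_le_right _ _)
        refine ⟨u, huT, htu, hus.le, ?_⟩
        have h1 := H u huT (by rw [abs_of_pos (sub_pos.2 htu)]; linarith)
        rw [← he, abs_sub_comm, abs_of_pos (sub_pos.2 htu)] at h1
        have e : f u - f t = -(f t - f u - f' t * ((t - u : ℝ) : ℂ)) + f' t * ((u - t : ℝ) : ℂ) := by
          push_cast
          ring
        rw [e]
        refine (norm_add_le _ _).trans ?_
        rw [norm_neg, norm_mul, Complex.norm_real, Real.norm_of_nonneg (sub_pos.2 htu).le]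
        nlinarith [mul_le_mul_of_nonneg_right hCt (sub_pos.2 htu).le]
      · refine ⟨sigma T t, sigma_mem hT htT, hjump, sigma_le hs hlt, ?_⟩
        rw [hD.sub_eq htT, norm_mul, Complex.norm_real, Real.norm_of_nonneg (mu_nonneg T t)]
        exact mul_le_mul_of_nonneg_right (by linarith) (mu_nonneg T t)
    have : u ≤ t := by
      refine hmax ⟨⟨huT, hrt.trans htu.le, hus⟩, ?_⟩
      calc ‖f u - f r‖ = ‖(f u - f t) + (f t - f r)‖ := by rw [sub_add_sub_cancel]
        _ ≤ ‖f u - f t‖ + ‖f t - f r‖ := norm_add_le _ _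
        _ ≤ (C + η) * (u - t) + (C + η) * (t - r) := add_le_add hu hb
        _ = (C + η) * (u - r) := by ring
    exact absurd htu (not_lt.2 this)
  have hlim : Tendsto (fun η : ℝ => (C + η) * (s - r)) (𝓝[>] 0) (𝓝 (C * (s - r))) := by
    have : Continuous fun η : ℝ => (C + η) * (s - r) := by fun_prop
    simpa using (this.tendsto 0).mono_left nhdsWithin_le_nhds
  exact ge_of_tendsto hlim (eventually_mem_nhdsWithin.mono key)

/-! ### Removing a left-scattered maximum -/

theorem kappa_subset (T : Set ℝ) : kappa T ⊆ T := fun _ h => h.1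

theorem mem_kappa_of_lt {s : ℝ} (ht : t ∈ T) (hs : s ∈ T) (hts : t < s) : t ∈ kappa T :=
  ⟨ht, fun h => absurd (h.1.2 hs) (not_le.2 hts)⟩

/-- A point of `T` outside `T^κ` is isolated in `T`. -/
theorem exists_forall_eq_of_notMem_kappa (ht : t ∈ T) (h : t ∉ kappa T) :
    ∃ ε > 0, ∀ s ∈ T, |s - t| < ε → s = t := by
  have h' : IsGreatest T t ∧ rho T t < t := by
    by_contra hn
    exact h ⟨ht, hn⟩
  refine ⟨t - rho T t, sub_pos.2 h'.2, fun s hs hst => ?_⟩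
  rcases (h'.1.2 hs).eq_or_lt with he | hlt
  · exact he
  · have hne : (T ∩ Iio t).Nonempty := ⟨s, hs, hlt⟩
    have h1 : s ≤ rho T t := by
      rw [rho, if_pos hne]
      exact le_csSup ⟨t, fun x hx => le_of_lt hx.2⟩ ⟨hs, hlt⟩
    have h2 := (abs_lt.1 hst).1
    linarith

theorem continuousWithinAt_of_notMem_kappa (ht : t ∈ T) (h : t ∉ kappa T) (f : ℝ → ℂ) :
    ContinuousWithinAt f T t := by
  obtain ⟨ε, hε, H⟩ := exists_forall_eq_of_notMem_kappa ht h
  rw [Metric.continuousWithinAt_iff]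
  exact fun η hη => ⟨ε, hε, fun {s} hs hst => by rwa [H s hs hst, dist_self]⟩

theorem isClosed_kappa (hT : IsClosed T) : IsClosed (kappa T) := by
  rw [← isSeqClosed_iff_isClosed]
  intro u x hu hux
  have hx : x ∈ T := hT.isSeqClosed (fun n => kappa_subset T (hu n)) hux
  by_contra hxk
  obtain ⟨ε, hε, H⟩ := exists_forall_eq_of_notMem_kappa hx hxk
  obtain ⟨N, hN⟩ := Metric.tendsto_atTop.1 hux ε hε
  have := H (u N) (hu N).1 (hN N le_rfl)
  exact hxk (this ▸ hu N)

theorem kappa_nonempty (hT : T.Nonempty) : (kappa T).Nonempty := by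
  obtain ⟨t, ht⟩ := hT
  by_contra hne
  rw [not_nonempty_iff_eq_empty] at hne
  have h' : IsGreatest T t ∧ rho T t < t := by
    by_contra hn
    exact (hne ▸ (⟨ht, hn⟩ : t ∈ kappa T) : t ∈ (∅ : Set ℝ))
  have hlt := h'.2
  rw [rho] at hlt
  split_ifs at hlt with h
  · obtain ⟨s, hs, hst⟩ := h
    exact (hne ▸ mem_kappa_of_lt hs ht hst : s ∈ (∅ : Set ℝ))
  · exact lt_irrefl _ hlt

/-- A function whose delta derivative vanishes on `T^κ` is constant on `T`. -/
theorem eq_of_hasDeltaDeriv_zero (hT : IsClosed T) {f : ℝ → ℂ}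
    (hf : ∀ t ∈ kappa T, HasDeltaDeriv T f 0 t) {r s : ℝ} (hr : r ∈ T) (hs : s ∈ T) :
    f s = f r := by
  wlog hrs : r ≤ s generalizing r s
  · exact (this hs hr (le_of_not_ge hrs)).symm
  have hc : ContinuousWithinAt f T s := by
    by_cases hk : s ∈ kappa T
    · exact (hf s hk).continuousWithinAt hs
    · exact continuousWithinAt_of_notMem_kappa hs hk f
  have h := norm_sub_le_of_norm_deltaDeriv_le hT (f' := fun _ => 0) (C := 0) hr hs hrs
    (fun t ht _ hts => hf t (mem_kappa_of_lt ht hs hts)) (fun _ _ _ _ => by simp) hc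
  rw [zero_mul, norm_le_zero_iff, sub_eq_zero] at h
  exact h

/-- Solutions of a first-order equation `x^Δ = z x` are multiples of any nowhere zero one. -/
theorem exists_eq_const_mul (hT : IsClosed T) (hne : T.Nonempty) {f g : ℝ → ℂ} {z : ℂ}
    (hf : ∀ t ∈ kappa T, HasDeltaDeriv T f (z * f t) t)
    (hg : ∀ t ∈ kappa T, HasDeltaDeriv T g (z * g t) t) (hg0 : ∀ s, g s ≠ 0) :
    ∃ c, ∀ t ∈ T, f t = c * g t := by
  obtain ⟨r, hr⟩ := hne
  refine ⟨f r / g r, fun t ht => ?_⟩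
  rw [← eq_of_hasDeltaDeriv_zero hT
    (fun t ht => (hf t ht).div_eq_zero (kappa_subset T ht) (hg t ht) hg0) hr ht,
    div_mul_cancel₀ _ (hg0 t)]

/-- If the delta derivative `y₁` of `y` on `T^κ` is continuous at `t`, it is also the delta
derivative of `y` at `t` with respect to `T^κ`. When `t` is the maximum of `T^κ`, the forward jump
of `t` changes on passing from `T` to `T^κ`, and `y₁ t` is to be a left derivative; this is where
the mean value inequality comes in. -/
theorem hasDeltaDeriv_kappa (hT : IsClosed T) {y y₁ : ℝ → ℂ}
    (hy : ∀ t ∈ kappa T, HasDeltaDeriv T y (y₁ t) t) (ht : t ∈ kappa T)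
    (hc : ContinuousWithinAt y₁ (kappa T) t) : HasDeltaDeriv (kappa T) y (y₁ t) t := by
  by_cases hne : (kappa T ∩ Ioi t).Nonempty
  · have hσ : sigma (kappa T) t = sigma T t := by
      have hne' : (T ∩ Ioi t).Nonempty := hne.mono (inter_subset_inter_left _ (kappa_subset T))
      apply le_antisymm
      · obtain ⟨u, hu, htu⟩ := hne
        rw [sigma.eq_1 T, if_pos hne']
        refine le_csInf hne' fun x hx => ?_
        by_cases hxk : x ∈ kappa T
        · exact sigma_le hxk hx.2
        · -- outside `T^κ`, `x` can only be the maximum of `T`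
          have hux : u ≤ x := by
            by_contra! hlt
            exact hxk (mem_kappa_of_lt hx.1 hu.1 hlt)
          exact (sigma_le hu htu).trans hux
      · rw [sigma.eq_1 (kappa T), if_pos hne]
        exact le_csInf hne fun x hx => sigma_le hx.1.1 hx.2
    intro ε hε
    obtain ⟨δ, hδ, h⟩ := hy t ht ε hε
    rw [hσ]
    exact ⟨δ, hδ, fun s hs => h s hs.1⟩
  · have hσ := sigma_eq_self_of_inter_Ioi_eq_empty hne
    intro ε hε
    obtain ⟨δ, hδ, h⟩ := Metric.continuousWithinAt_iff.1 hc ε hε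
    refine ⟨δ, hδ, fun s hs hst => ?_⟩
    have hle : s ≤ t := by
      by_contra! hlt
      exact hne ⟨s, hs, hlt⟩
    rw [hσ, abs_of_nonneg (sub_nonneg.2 hle)]
    have hcy : ContinuousWithinAt (fun x : ℝ => y x - y₁ t * (x : ℂ)) T t :=
      ((hy t ht).sub ((hasDeltaDeriv_id T t).const_mul (y₁ t))).continuousWithinAt ht.1
    have hmem : ∀ x ∈ T, x < t → x ∈ kappa T := fun x hx hxt => mem_kappa_of_lt hx ht.1 hxt
    have := norm_sub_le_of_norm_deltaDeriv_le hT (f' := fun x => y₁ x - y₁ t * 1) (C := ε)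
      hs.1 ht.1 hle
      (fun x hx _ hxt => (hy x (hmem x hx hxt)).sub ((hasDeltaDeriv_id T x).const_mul (y₁ t)))
      (fun x hx hsx hxt => by
        have h1 : dist x t < δ := by
          rw [abs_sub_comm, abs_of_nonneg (sub_nonneg.2 hle)] at hst
          rw [Real.dist_eq, abs_sub_comm, abs_of_pos (sub_pos.2 hxt)]
          linarith
        have h2 := h (hmem x hx hxt) h1
        rw [dist_eq_norm] at h2
        simpa using h2.le) hcy
    convert this using 2
    push_cast
    ring

/-! ### The delta integral -/

theorem ae_mem_deltaMeasure (hT : IsClosed T) : ∀ᵐ τ ∂deltaMeasure T, τ ∈ T :=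
  mem_ae_iff.2 (deltaMeasure_compl hT)

/-- A function with limits at the punctured points of `T` is bounded on bounded parts of `T`, and
so integrable there. -/
theorem integrableOn_Ico_of_tendsto (hT : IsClosed T) {f : ℝ → ℂ}
    (hf : AEStronglyMeasurable f (deltaMeasure T))
    (hlim : ∀ t ∈ T, ∃ z, Tendsto f (𝓝[T \ {t}] t) (𝓝 z)) {c d : ℝ} (hc : c ∈ T) (hd : d ∈ T) :
    IntegrableOn f (Ico c d) (deltaMeasure T) := by
  have hK : IsCompact (T ∩ Icc c d) := isCompact_Icc.inter_left hT
  obtain ⟨C, hC⟩ : ∃ C, ∀ τ ∈ T ∩ Icc c d, ‖f τ‖ ≤ C := by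
    refine hK.induction_on (p := fun s => ∃ C, ∀ τ ∈ s, ‖f τ‖ ≤ C) ⟨0, by simp⟩
      (fun s u hsu ⟨C, hC⟩ => ⟨C, fun τ hτ => hC τ (hsu hτ)⟩)
      (fun s u ⟨C, hC⟩ ⟨D, hD⟩ => ⟨max C D, fun τ hτ => hτ.elim
        (fun h => (hC τ h).trans (le_max_left _ _)) fun h => (hD τ h).trans (le_max_right _ _)⟩) ?_
    intro t ht
    obtain ⟨z, hz⟩ := hlim t ht.1
    have h1 : ∀ᶠ τ in 𝓝[T \ {t}] t, ‖f τ‖ < ‖z‖ + 1 :=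
      hz.norm.eventually_lt_const (lt_add_one _)
    have h2 : {τ | τ ∈ T \ {t} → ‖f τ‖ < ‖z‖ + 1} ∈ 𝓝 t := eventually_nhdsWithin_iff.1 h1
    refine ⟨_, inter_mem (mem_nhdsWithin_of_mem_nhds h2) self_mem_nhdsWithin,
      max ‖f t‖ (‖z‖ + 1), fun τ hτ => ?_⟩
    by_cases h : τ = t
    · rw [h]
      exact le_max_left _ _
    · exact (hτ.1 ⟨hτ.2.1, h⟩).le.trans (le_max_right _ _)
  refine Measure.integrableOn_of_bounded (M := C) ?_ hf ?_
  · rw [deltaMeasure_Ico hT hc hd]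
    exact ENNReal.ofReal_ne_top
  · filter_upwards [ae_restrict_mem measurableSet_Ico, ae_restrict_of_ae (ae_mem_deltaMeasure hT)]
      with τ h1 h2
    exact hC τ ⟨h2, Ico_subset_Icc_self h1⟩

theorem deltaIntegral_self (T : Set ℝ) (f : ℝ → ℂ) (a : ℝ) : deltaIntegral T f a a = 0 := by
  simp [deltaIntegral]

theorem deltaIntegral_sub {f : ℝ → ℂ} {a r s : ℝ}
    (hf : ∀ c ∈ T, ∀ d ∈ T, IntegrableOn f (Ico c d) (deltaMeasure T))
    (ha : a ∈ T) (hr : r ∈ T) (hs : s ∈ T) (hrs : r ≤ s) :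
    deltaIntegral T f a s - deltaIntegral T f a r = ∫ τ in Ico r s, f τ ∂deltaMeasure T := by
  have add : ∀ {p q u : ℝ}, p ∈ T → q ∈ T → u ∈ T → p ≤ q → q ≤ u →
      ∫ τ in Ico p u, f τ ∂deltaMeasure T
        = (∫ τ in Ico p q, f τ ∂deltaMeasure T) + ∫ τ in Ico q u, f τ ∂deltaMeasure T := by
    intro p q u hp hq hu hpq hqu
    rw [← Ico_union_Ico_eq_Ico hpq hqu]
    refine setIntegral_union ?_ measurableSet_Ico (hf p hp q hq) (hf q hq u hu)
    rw [Set.disjoint_left]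
    exact fun x h1 h2 => absurd h1.2 (not_lt.2 h2.1)
  unfold deltaIntegral
  by_cases har : a ≤ r
  · rw [if_pos har, if_pos (har.trans hrs), add ha hr hs har hrs]
    ring
  · rw [if_neg har]
    rw [not_le] at har
    by_cases has : a ≤ s
    · rw [if_pos has, add hr ha hs har.le has]
      ring
    · rw [if_neg has]
      rw [not_le] at has
      rw [add hr hs ha hrs has.le]
      ring

theorem norm_setIntegral_Ico_sub_le (hT : IsClosed T) {f : ℝ → ℂ} {c d ε : ℝ} {z : ℂ}
    (hc : c ∈ T) (hd : d ∈ T) (hcd : c ≤ d) (hf : IntegrableOn f (Ico c d) (deltaMeasure T))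
    (hb : ∀ᵐ τ ∂deltaMeasure T, τ ∈ T → c ≤ τ → τ < d → ‖f τ - z‖ ≤ ε) :
    ‖∫ τ in Ico c d, f τ ∂deltaMeasure T - (d - c) • z‖ ≤ ε * (d - c) := by
  have hfin : deltaMeasure T (Ico c d) < ⊤ := by
    rw [deltaMeasure_Ico hT hc hd]
    exact ENNReal.ofReal_lt_top
  have hreal : (deltaMeasure T).real (Ico c d) = d - c := by
    rw [Measure.real, deltaMeasure_Ico hT hc hd, ENNReal.toReal_ofReal (sub_nonneg.2 hcd)]
  have h1 : ∫ τ in Ico c d, f τ ∂deltaMeasure T - (d - c) • z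
      = ∫ τ in Ico c d, (f τ - z) ∂deltaMeasure T := by
    rw [integral_sub hf (integrableOn_const hfin.ne), setIntegral_const, hreal]
  rw [h1, ← hreal]
  refine norm_setIntegral_le_of_norm_le_const_ae hfin ?_
  filter_upwards [ae_restrict_mem measurableSet_Ico, ae_restrict_of_ae (ae_mem_deltaMeasure hT),
    ae_restrict_of_ae hb] with τ h1 h2 h3
  exact h3 h2 h1.1 h1.2

theorem setIntegral_Ico_sigma (hT : IsClosed T) {f : ℝ → ℂ} (ht : t ∈ T)
    (hf : IntegrableOn f (Ico t (sigma T t)) (deltaMeasure T)) :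
    ∫ τ in Ico t (sigma T t), f τ ∂deltaMeasure T = f t * (mu T t : ℂ) := by
  have h := norm_setIntegral_Ico_sub_le hT (z := f t) (ε := 0) ht (sigma_mem hT ht)
    (le_sigma T t) hf (Eventually.of_forall fun τ hτ h1 h2 => by
      rw [le_antisymm (le_of_lt_sigma hτ h2) h1, sub_self, norm_zero])
  rw [zero_mul, norm_le_zero_iff, sub_eq_zero] at h
  rw [h, Complex.real_smul, mul_comm]
  rfl

/-- The fundamental theorem of calculus, for an ordinary derivative within `T`. The value of the
integrand at `t` does not matter: for right-dense `t` the point `t` is a null set, and for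
right-scattered `t` the difference quotients only involve the integrand to the left of `t`. -/
theorem hasDerivWithinAt_deltaIntegral (hT : IsClosed T) {f : ℝ → ℂ} {a : ℝ} {z : ℂ}
    (hf : ∀ c ∈ T, ∀ d ∈ T, IntegrableOn f (Ico c d) (deltaMeasure T))
    (ha : a ∈ T) (ht : t ∈ T) (hz : Tendsto f (𝓝[T \ {t}] t) (𝓝 z)) :
    HasDerivWithinAt (deltaIntegral T f a) z T t := by
  rw [hasDerivWithinAt_iff_isLittleO, Asymptotics.isLittleO_iff]
  intro ε hε
  obtain ⟨δ, hδ, H⟩ := Metric.tendsto_nhdsWithin_nhds.1 hz ε hε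
  have H' : ∀ τ ∈ T, τ ≠ t → |τ - t| < δ → ‖f τ - z‖ ≤ ε := by
    intro τ hτ hne hτt
    rw [← dist_eq_norm]
    exact (H ⟨hτ, hne⟩ hτt).le
  have left : ∀ s ∈ T, s ≤ t → |s - t| < δ →
      ‖deltaIntegral T f a s - deltaIntegral T f a t - (s - t) • z‖ ≤ ε * ‖s - t‖ := by
    intro s hs hst hsδ
    rw [abs_sub_comm, abs_of_nonneg (sub_nonneg.2 hst)] at hsδ
    have := norm_setIntegral_Ico_sub_le hT (z := z) (ε := ε) hs ht hst (hf s hs t ht)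
      (Eventually.of_forall fun τ hτ h1 h2 => H' τ hτ h2.ne (by
        rw [abs_sub_comm, abs_of_pos (sub_pos.2 h2)]
        linarith))
    rw [← deltaIntegral_sub hf ha hs ht hst] at this
    have e : deltaIntegral T f a s - deltaIntegral T f a t - (s - t) • z
        = -(deltaIntegral T f a t - deltaIntegral T f a s - (t - s) • z) := by
      simp only [Complex.real_smul]
      push_cast
      ring
    rw [e, norm_neg, Real.norm_eq_abs, abs_sub_comm, abs_of_nonneg (sub_nonneg.2 hst)]
    exact this
  rw [eventually_nhdsWithin_iff, Metric.eventually_nhds_iff]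
  rcases (le_sigma T t).eq_or_lt with he | hlt
  · refine ⟨δ, hδ, fun s hst hs => ?_⟩
    rw [Real.dist_eq] at hst
    rcases le_or_gt s t with hle | hgt
    · exact left s hs hle hst
    · rw [abs_of_pos (sub_pos.2 hgt)] at hst
      have h0 : deltaMeasure T {t} = 0 := by
        -- `{t}` lies in `[t, u)` for points `u` of `T` that are arbitrarily close to `t`
        have hne : (T ∩ Ioi t).Nonempty := ⟨s, hs, hgt⟩
        refine le_antisymm (ENNReal.le_of_forall_pos_le_add fun η hη _ => ?_) bot_le
        have hinf : sInf (T ∩ Ioi t) < t + η := by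
          rw [sigma, if_pos hne] at he
          rw [← he]
          exact lt_add_of_pos_right _ hη
        obtain ⟨u, ⟨huT, htu⟩, hu⟩ := exists_lt_of_csInf_lt hne hinf
        rw [mem_Ioi] at htu
        calc deltaMeasure T {t} ≤ deltaMeasure T (Ico t u) :=
              measure_mono (singleton_subset_iff.2 ⟨le_rfl, htu⟩)
          _ = ENNReal.ofReal (u - t) := deltaMeasure_Ico hT ht huT
          _ ≤ ENNReal.ofReal η := ENNReal.ofReal_le_ofReal (by linarith)
          _ = 0 + η := by rw [zero_add, ENNReal.ofReal_coe_nnreal]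
      have hae : ∀ᵐ τ ∂deltaMeasure T, τ ≠ t := mem_ae_iff.2 (by simpa using h0)
      have := norm_setIntegral_Ico_sub_le hT (z := z) (ε := ε) ht hs hgt.le (hf t ht s hs)
        (hae.mono fun τ hne hτ h1 h2 => H' τ hτ hne (by
          rw [abs_of_nonneg (sub_nonneg.2 h1)]
          linarith))
      rw [← deltaIntegral_sub hf ha ht hs hgt.le] at this
      rwa [Real.norm_of_nonneg (sub_pos.2 hgt).le]
  · refine ⟨min δ (mu T t), lt_min hδ (sub_pos.2 hlt), fun s hst hs => ?_⟩
    rw [Real.dist_eq] at hst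
    have hle : s ≤ t := by
      refine le_of_lt_sigma hs ?_
      have := (abs_lt.1 (hst.trans_le (min_le_right _ _))).2
      unfold mu at this
      linarith
    exact left s hs hle (hst.trans_le (min_le_left _ _))

/-! ### The time-scale polynomials -/

theorem ofReal_deltaIntegral (T : Set ℝ) (f : ℝ → ℝ) (a t : ℝ) :
    ((deltaIntegral T f a t : ℝ) : ℂ) = deltaIntegral T (fun τ => (f τ : ℂ)) a t := by
  unfold deltaIntegral
  split_ifs
  · exact integral_ofReal.symm
  · rw [Complex.ofReal_neg]
    exact congrArg _ integral_ofReal.symm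

/-- The fundamental theorem of calculus for a continuous integrand, with the delta derivative. -/
theorem hasDeltaDeriv_deltaIntegral (hT : IsClosed T) {f : ℝ → ℂ} {a : ℝ}
    (hf : ContinuousOn f T) (ha : a ∈ T) (ht : t ∈ T) :
    HasDeltaDeriv T (deltaIntegral T f a) (f t) t := by
  have hlim : ∀ t ∈ T, Tendsto f (𝓝[T \ {t}] t) (𝓝 (f t)) := fun t ht =>
    (hf t ht).mono_left (nhdsWithin_mono t sdiff_subset)
  have hmeas : AEStronglyMeasurable f (deltaMeasure T) := by
    rw [← Measure.restrict_eq_self_of_ae_mem (ae_mem_deltaMeasure hT)]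
    exact hf.aestronglyMeasurable hT.measurableSet
  have hint : ∀ c ∈ T, ∀ d ∈ T, IntegrableOn f (Ico c d) (deltaMeasure T) := fun c hc d hd =>
    integrableOn_Ico_of_tendsto hT hmeas (fun t ht => ⟨_, hlim t ht⟩) hc hd
  have hD := hasDerivWithinAt_deltaIntegral hT hint ha ht (hlim t ht)
  rcases (le_sigma T t).eq_or_lt with he | hlt
  · exact (hasDeltaDeriv_iff_of_sigma_eq he.symm).2 hD
  · refine (hasDeltaDeriv_iff_of_lt_sigma ht hlt).2 ⟨hD.continuousWithinAt, ?_⟩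
    rw [deltaIntegral_sub hint ha ht (sigma_mem hT ht) hlt.le,
      setIntegral_Ico_sigma hT ht (hint t ht _ (sigma_mem hT ht))]

theorem continuousOn_hPoly (hT : IsClosed T) {a : ℝ} (ha : a ∈ T) (i : ℕ) :
    ContinuousOn (fun t => (hPoly T a i t : ℂ)) T := by
  induction i with
  | zero =>
    simp only [hPoly]
    exact continuousOn_const
  | succ i ih =>
    intro t ht
    simp only [hPoly, ofReal_deltaIntegral]
    exact (hasDeltaDeriv_deltaIntegral hT ih ha ht).continuousWithinAt ht

theorem hasDeltaDeriv_hPoly_succ (hT : IsClosed T) {a : ℝ} (ha : a ∈ T) (i : ℕ) (ht : t ∈ T) :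
    HasDeltaDeriv T (fun t => (hPoly T a (i + 1) t : ℂ)) (hPoly T a i t : ℂ) t := by
  simp only [hPoly, ofReal_deltaIntegral]
  exact hasDeltaDeriv_deltaIntegral hT (continuousOn_hPoly hT ha i) ha ht

/-! ### The time-scale exponential -/

theorem measurable_cylinder (z : ℂ) : Measurable fun h => cylinder h z := by
  unfold cylinder
  refine Measurable.ite (measurableSet_singleton 0) measurable_const ?_
  exact (Complex.measurable_log.comp (by fun_prop)).div (by fun_prop)

theorem continuousAt_cylinder (z : ℂ) : ContinuousAt (fun h => cylinder h z) 0 := by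
  have h1 : HasDerivAt (fun h : ℝ => Complex.log (1 + z * h)) z 0 := by
    have h2 : HasDerivAt (fun h : ℝ => 1 + z * (h : ℂ)) z 0 := by
      simpa using ((Complex.ofRealCLM.hasDerivAt (x := (0 : ℝ))).const_mul z).const_add 1
    simpa using h2.clog_real (by simp)
  rw [hasDerivAt_iff_tendsto_slope] at h1
  have h0 : cylinder 0 z = z := if_pos rfl
  simp only [continuousAt_iff_punctured_nhds, h0]
  refine h1.congr' (eventually_mem_nhdsWithin.mono fun h hh => ?_)
  have hc : cylinder h z = Complex.log (1 + z * h) / h := if_neg hh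
  simp [hc, slope_def_module, div_eq_inv_mul]

theorem tsExp_ne_zero (T : Set ℝ) (z : ℂ) (t a : ℝ) : tsExp T z t a ≠ 0 := Complex.exp_ne_zero _

theorem tsExp_self (T : Set ℝ) (z : ℂ) (a : ℝ) : tsExp T z a a = 1 := by
  rw [tsExp, deltaIntegral_self, Complex.exp_zero]

/-- The exponential of a constant `z` solves `x^Δ = z x`. At a right-scattered point this is
`exp (Log (1 + z μ)) = 1 + z μ`, which needs `1 + z μ ≠ 0`. -/
theorem hasDeltaDeriv_tsExp (hT : IsClosed T) {a : ℝ} (ha : a ∈ T) {z : ℂ} (ht : t ∈ T)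
    (hz : 1 + z * mu T t ≠ 0) :
    HasDeltaDeriv T (fun s => tsExp T z s a) (z * tsExp T z t a) t := by
  have hlim : ∀ t ∈ T, Tendsto (fun τ => cylinder (mu T τ) z) (𝓝[T \ {t}] t) (𝓝 z) := by
    intro t ht
    have := (continuousAt_cylinder z).tendsto.comp (tendsto_mu ht)
    rwa [cylinder, if_pos rfl] at this
  have hint : ∀ c ∈ T, ∀ d ∈ T,
      IntegrableOn (fun τ => cylinder (mu T τ) z) (Ico c d) (deltaMeasure T) := fun c hc d hd =>
    integrableOn_Ico_of_tendsto hT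
      ((measurable_cylinder z).comp (measurable_mu T)).aestronglyMeasurable
      (fun t ht => ⟨z, hlim t ht⟩) hc hd
  have hD : HasDerivWithinAt (fun s => tsExp T z s a) (tsExp T z t a * z) T t :=
    (hasDerivWithinAt_deltaIntegral hT hint ha ht (hlim t ht)).cexp
  rcases (le_sigma T t).eq_or_lt with he | hlt
  · rw [mul_comm]
    exact (hasDeltaDeriv_iff_of_sigma_eq he.symm).2 hD
  · refine (hasDeltaDeriv_iff_of_lt_sigma ht hlt).2 ⟨hD.continuousWithinAt, ?_⟩
    have hmu : mu T t ≠ 0 := (sub_pos.2 hlt).ne'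
    have h1 := deltaIntegral_sub hint ha ht (sigma_mem hT ht) hlt.le
    rw [setIntegral_Ico_sigma hT ht (hint t ht _ (sigma_mem hT ht)), cylinder, if_neg hmu,
      div_mul_cancel₀ _ (Complex.ofReal_ne_zero.2 hmu), sub_eq_iff_eq_add'] at h1
    have h2 : tsExp T z (sigma T t) a = tsExp T z t a * (1 + z * mu T t) := by
      rw [tsExp, h1, Complex.exp_add, Complex.exp_log hz, tsExp]
    simp only [h2]
    ring

/-- For real `z` the exponential is real although `Log (1 + z μ)` need not be: it and its complex
conjugate solve the same first-order equation with the same value at `a`. -/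
theorem im_tsExp_eq_zero (hT : IsClosed T) {a : ℝ} (ha : a ∈ T) {z : ℂ} (hz : z.im = 0)
    (hreg : ∀ t ∈ T, 1 + z * mu T t ≠ 0) (ht : t ∈ T) : (tsExp T z t a).im = 0 := by
  have hz' : starRingEnd ℂ z = z := Complex.conj_eq_iff_im.2 hz
  have hD : ∀ t ∈ kappa T, HasDeltaDeriv T (fun s => tsExp T z s a) (z * tsExp T z t a) t :=
    fun t ht => hasDeltaDeriv_tsExp hT ha ht.1 (hreg t ht.1)
  obtain ⟨c, hc⟩ := exists_eq_const_mul hT ⟨a, ha⟩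
    (f := fun s => starRingEnd ℂ (tsExp T z s a))
    (fun t ht => by simpa [hz'] using (hD t ht).conj) hD (fun s => tsExp_ne_zero T z s a)
  have h1 : c = 1 := by simpa [tsExp_self] using (hc a ha).symm
  have := hc t ht
  rw [h1, one_mul] at this
  exact Complex.conj_eq_iff_im.1 this

/-! ### The characteristic roots and the coefficients -/

theorem root_sq (α β : ℝ) : root α β ^ 2 = (α : ℂ) ^ 2 - β := by
  have := Complex.cpow_nat_inv_pow ((α : ℂ) ^ 2 - β) two_ne_zero
  rwa [Nat.cast_ofNat, ← one_div] at this

theorem root_ne_zero {α β : ℝ} (hαβ : β ≠ α ^ 2) : root α β ≠ 0 := by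
  intro h
  have h1 := root_sq α β
  rw [h, zero_pow two_ne_zero, eq_comm, sub_eq_zero] at h1
  exact hαβ (by exact_mod_cast h1.symm)

theorem im_root_eq_zero {α β : ℝ} (h : β < α ^ 2) : (root α β).im = 0 := by
  have h1 : root α β = (((α ^ 2 - β) ^ (1 / 2 : ℝ) : ℝ) : ℂ) := by
    rw [Complex.ofReal_cpow (sub_nonneg.2 h.le), root]
    push_cast
    rfl
  rw [h1, Complex.ofReal_im]

theorem lam1_add_lam2 (α β : ℝ) : lam1 α β + lam2 α β = -2 * α := by
  unfold lam1 lam2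
  ring

theorem lam2_sub_lam1 (α β : ℝ) : lam2 α β - lam1 α β = 2 * root α β := by
  unfold lam1 lam2
  ring

theorem lam1_mul_lam2 (α β : ℝ) : lam1 α β * lam2 α β = β := by
  unfold lam1 lam2
  linear_combination -root_sq α β

/-- The regressivity condition on `α` and `β` is the one on both characteristic roots. -/
theorem one_add_lam1_mul_mul (α β m : ℝ) :
    (1 + lam1 α β * m) * (1 + lam2 α β * m) = ((1 - 2 * α * m + β * m ^ 2 : ℝ) : ℂ) := by
  push_cast
  linear_combination (m : ℂ) * lam1_add_lam2 α β + (m : ℂ) ^ 2 * lam1_mul_lam2 α β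

/-- The double sum solves the inhomogeneous difference equation. Writing `R i` for the summand
`τ = i` of the outer sum for `i + 1`, this comes from the pair of first-order recursions
`S (i + 1) = λ₁ S i + R i` and `R (i + 1) = λ₂ R i + γ i`. -/
theorem dblSum_add_two {α β : ℝ} (hβ : β ≠ 0) (γ : ℕ → ℝ) (i : ℕ) :
    dblSum α β γ (i + 2) + 2 * α * dblSum α β γ (i + 1) + β * dblSum α β γ i = γ i := by
  have hβ' : (β : ℂ) ≠ 0 := Complex.ofReal_ne_zero.2 hβ
  have hmul := lam1_mul_lam2 α β
  have hadd := lam1_add_lam2 α β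
  have h1 : lam1 α β ≠ 0 := left_ne_zero_of_mul (hmul ▸ hβ')
  set R : ℕ → ℂ := fun i => ∑ s ∈ Finset.range i,
    (γ s : ℂ) * lam1 α β ^ (((i + 1 : ℕ) : ℤ) + s - 2 * i) * (β : ℂ) ^ ((i : ℤ) - 1 - s) with hR
  have hS : ∀ i, dblSum α β γ (i + 1) = lam1 α β * dblSum α β γ i + R i := by
    intro i
    rw [dblSum, Finset.sum_range_succ, dblSum, Finset.mul_sum]
    congr 1
    refine Finset.sum_congr rfl fun τ _ => ?_
    rw [Finset.mul_sum]
    refine Finset.sum_congr rfl fun s _ => ?_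
    rw [show ((i + 1 : ℕ) : ℤ) + s - 2 * τ = ((i : ℤ) + s - 2 * τ) + 1 by push_cast; ring,
      zpow_add_one₀ h1]
    ring
  have hRs : ∀ i, R (i + 1) = lam2 α β * R i + γ i := by
    intro i
    simp only [hR]
    rw [Finset.sum_range_succ, Finset.mul_sum]
    congr 1
    · refine Finset.sum_congr rfl fun s _ => ?_
      rw [show ((i + 1 : ℕ) : ℤ) + s - 2 * i = ((i + 1 + 1 : ℕ) : ℤ) + s - 2 * (i + 1 : ℕ) + 1 by
          push_cast; ring, zpow_add_one₀ h1,
        show ((i + 1 : ℕ) : ℤ) - 1 - s = (i : ℤ) - 1 - s + 1 by push_cast; ring,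
        zpow_add_one₀ hβ', ← hmul]
      ring
    · rw [show ((i + 1 + 1 : ℕ) : ℤ) + i - 2 * (i + 1 : ℕ) = 0 by push_cast; ring,
        show ((i + 1 : ℕ) : ℤ) - 1 - i = 0 by push_cast; ring]
      simp
  have e1 := hS i
  have e2 := hS (i + 1)
  have e3 := hRs i
  linear_combination e2 + e3 - lam2 α β * e1 + dblSum α β γ (i + 1) * hadd
    - dblSum α β γ i * hmul

/-- The formula for `ξ_i` with `i ≤ k - 2` also holds for the terminal values `i = k - 1` and
`i = k`: this is what `ω₁` and `ω₂` are chosen for. -/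
theorem xi_eq {α β : ℝ} (hβ : β ≠ 0) (hαβ : β ≠ α ^ 2) (γ : ℕ → ℝ) {k i : ℕ} (hk : 2 ≤ k)
    (hi : i ≤ k) :
    xi α β γ k i = omega α β γ k 0 * lam1 α β ^ i + omega α β γ k 1 * lam2 α β ^ i
      + dblSum α β γ i := by
  have hβ' : (β : ℂ) ≠ 0 := Complex.ofReal_ne_zero.2 hβ
  have hr := root_ne_zero hαβ
  obtain ⟨n, rfl⟩ : ∃ n, k = n + 1 := ⟨k - 1, by omega⟩
  have h0 : omega α β γ (n + 1) 0 = 1 / (2 * (β : ℂ) ^ n * root α β) *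
      (lam2 α β ^ (n + 1) * (xiPrev α β γ (n + 1) - dblSum α β γ n)
        - lam2 α β ^ n * (xiLast β γ (n + 1) - dblSum α β γ (n + 1))) := by
    simp [omega]
    exact Or.inl (by ring)
  have h1 : omega α β γ (n + 1) 1 = 1 / (2 * (β : ℂ) ^ n * root α β) *
      (-lam1 α β ^ (n + 1) * (xiPrev α β γ (n + 1) - dblSum α β γ n)
        + lam1 α β ^ n * (xiLast β γ (n + 1) - dblSum α β γ (n + 1))) := by
    simp [omega]
    exact Or.inl (by ring)
  have hpow : (β : ℂ) ^ n = lam1 α β ^ n * lam2 α β ^ n := by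
    rw [← mul_pow, lam1_mul_lam2]
  have hsub := lam2_sub_lam1 α β
  have hden : 1 / (2 * (β : ℂ) ^ n * root α β)
      * (lam1 α β ^ n * lam2 α β ^ n * (lam2 α β - lam1 α β)) = 1 := by
    rw [← hpow, hsub]
    field_simp
  unfold xi
  split_ifs with hik hik'
  · subst hik
    rw [h0, h1]
    linear_combination (-(xiLast β γ (n + 1) - dblSum α β γ (n + 1))) * hden
  · obtain rfl : i = n := by omega
    rw [h0, h1]
    linear_combination (-(xiPrev α β γ (i + 1) - dblSum α β γ i)) * hden
  · rfl

theorem xi_add_two {α β : ℝ} (hβ : β ≠ 0) (hαβ : β ≠ α ^ 2) (γ : ℕ → ℝ) {k i : ℕ}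
    (hi : i + 2 ≤ k) :
    xi α β γ k (i + 2) + 2 * α * xi α β γ k (i + 1) + β * xi α β γ k i = γ i := by
  have hk : 2 ≤ k := by omega
  rw [xi_eq hβ hαβ γ hk hi, xi_eq hβ hαβ γ hk (by omega), xi_eq hβ hαβ γ hk (by omega)]
  -- both characteristic roots satisfy `λ² + 2 α λ + β = 0`
  have q1 : lam1 α β ^ 2 + 2 * α * lam1 α β + β = 0 := by
    linear_combination lam1 α β * lam1_add_lam2 α β - lam1_mul_lam2 α β
  have q2 : lam2 α β ^ 2 + 2 * α * lam2 α β + β = 0 := by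
    linear_combination lam2 α β * lam1_add_lam2 α β - lam1_mul_lam2 α β
  linear_combination omega α β γ k 0 * lam1 α β ^ i * q1 + omega α β γ k 1 * lam2 α β ^ i * q2
    + dblSum_add_two hβ γ i

theorem xi_last (α β : ℝ) (γ : ℕ → ℝ) (k : ℕ) : xi α β γ k k = xiLast β γ k := if_pos rfl

theorem xi_prev (α β : ℝ) (γ : ℕ → ℝ) (k : ℕ) :
    xi α β γ (k + 1) k = xiPrev α β γ (k + 1) := by
  rw [xi, if_neg (Nat.succ_ne_self k).symm, if_pos rfl]

/-- The coefficients are real even for non-real `λ₁` and `λ₂`: solve the difference equation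
downwards from the real terminal values. -/
theorem exists_real_xi_eq {α β : ℝ} (hβ : β ≠ 0) (hαβ : β ≠ α ^ 2) (γ : ℕ → ℝ) (j : ℕ) :
    ∀ i, ∃ r : ℝ, xi α β γ (i + j) i = r := by
  have hβ' : (β : ℂ) ≠ 0 := Complex.ofReal_ne_zero.2 hβ
  induction j using Nat.twoStepInduction with
  | zero =>
    intro i
    refine ⟨1 / β * γ i, ?_⟩
    rw [Nat.add_zero, xi_last, xiLast]
    push_cast
    rfl
  | one =>
    intro i
    refine ⟨1 / β * (γ i - 2 * α / β * γ (i + 1)), ?_⟩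
    rw [xi_prev, xiPrev, Nat.add_sub_cancel]
    push_cast
    rfl
  | more j ih0 ih1 =>
    intro i
    obtain ⟨p, hp⟩ := ih1 (i + 1)
    obtain ⟨q, hq⟩ := ih0 (i + 2)
    rw [show i + 1 + (j + 1) = i + (j + 2) by ring] at hp
    rw [show i + 2 + j = i + (j + 2) by ring] at hq
    have h := xi_add_two hβ hαβ γ (k := i + (j + 2)) (i := i) (by omega)
    rw [hp, hq] at h
    refine ⟨(γ i - q - 2 * α * p) / β, ?_⟩
    push_cast
    rw [eq_div_iff hβ']
    linear_combination h

theorem im_xi_eq_zero {α β : ℝ} (hβ : β ≠ 0) (hαβ : β ≠ α ^ 2) (γ : ℕ → ℝ) {k i : ℕ}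
    (hi : i ≤ k) : (xi α β γ k i).im = 0 := by
  obtain ⟨j, rfl⟩ := Nat.exists_eq_add_of_le hi
  obtain ⟨r, hr⟩ := exists_real_xi_eq hβ hαβ γ j i
  rw [hr, Complex.ofReal_im]

/-! ### The second-order equation -/

theorem IsSolution.congr {α β : ℝ} {f y x : ℝ → ℂ} (hT : IsClosed T) (hy : IsSolution T α β f y)
    (h : ∀ t ∈ T, x t = y t) : IsSolution T α β f x := by
  obtain ⟨y₁, y₂, h1, h2, h3⟩ := hy
  refine ⟨y₁, y₂, fun t ht => (h1 t ht).congr hT ht.1 h, h2, fun t ht => ?_⟩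
  rw [h t ht.1.1]
  exact h3 t ht

theorem isSolution_of_hasDeltaDeriv {α β : ℝ} {f y y₁ y₂ : ℝ → ℂ} (hT : IsClosed T)
    (h1 : ∀ t ∈ T, HasDeltaDeriv T y (y₁ t) t)
    (h2 : ∀ t ∈ T, HasDeltaDeriv T y₁ (y₂ t) t) (h3 : ContinuousOn y₂ T)
    (h : ∀ t ∈ T, y₂ t + 2 * α * y₁ t + β * y t = f t) : IsSolution T α β f y :=
  ⟨y₁, y₂, fun t ht => h1 t ht.1,
    fun _ ht => hasDeltaDeriv_kappa hT (fun s hs => h2 s hs.1) ht.1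
      ((h3 _ ht.1.1).mono (kappa_subset T)),
    fun t ht => h t ht.1.1⟩

/-- Two solutions differ by a combination of the exponentials of the characteristic roots. If `d`
is the difference, then `d^Δ - λ₁ d` solves the first-order equation for `λ₂` on `T^κ`, and
subtracting a multiple of the second exponential from `d` leaves a solution of the first-order
equation for `λ₁` on `T`. -/
theorem exists_eq_add_of_isSolution (hT : IsClosed T) (hne : T.Nonempty) {α β : ℝ}
    (hαβ : β ≠ α ^ 2) {f y p e₁ e₂ : ℝ → ℂ}
    (he₁ : ∀ t ∈ T, HasDeltaDeriv T e₁ (lam1 α β * e₁ t) t)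
    (he₂ : ∀ t ∈ T, HasDeltaDeriv T e₂ (lam2 α β * e₂ t) t)
    (he₁0 : ∀ t, e₁ t ≠ 0) (he₂0 : ∀ t, e₂ t ≠ 0)
    (hy : IsSolution T α β f y) (hp : IsSolution T α β f p) :
    ∃ c₁ c₂ : ℂ, ∀ t ∈ T, y t = c₁ * e₁ t + c₂ * e₂ t + p t := by
  obtain ⟨y₁, y₂, hy1, hy2, hy3⟩ := hy
  obtain ⟨p₁, p₂, hp1, hp2, hp3⟩ := hp
  have hmul := lam1_mul_lam2 α β
  have hadd := lam1_add_lam2 α β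
  have hd1 : ∀ t ∈ kappa T, HasDeltaDeriv T (fun s => y s - p s) (y₁ t - p₁ t) t :=
    fun t ht => (hy1 t ht).sub (hp1 t ht)
  have hd2 : ∀ t ∈ kappa (kappa T),
      HasDeltaDeriv (kappa T) (fun s => y₁ s - p₁ s) (y₂ t - p₂ t) t :=
    fun t ht => (hy2 t ht).sub (hp2 t ht)
  obtain ⟨C, hC⟩ := exists_eq_const_mul (isClosed_kappa hT) (kappa_nonempty hne)
    (f := fun s => y₁ s - p₁ s - lam1 α β * (y s - p s)) (g := e₂) (z := lam2 α β)
    (fun t ht => by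
      have h := (hd2 t ht).sub
        ((hasDeltaDeriv_kappa hT hd1 ht.1 ((hd2 t ht).continuousWithinAt ht.1)).const_mul
          (lam1 α β))
      convert h using 1
      linear_combination (y₁ t - p₁ t) * hadd - (y t - p t) * hmul - hy3 t ht + hp3 t ht)
    (fun t ht => hasDeltaDeriv_kappa hT (fun s hs => he₂ s hs.1) ht.1
      ((((he₂ t ht.1.1).continuousWithinAt ht.1.1).const_mul (lam2 α β)).mono (kappa_subset T)))
    he₂0
  have hsub : lam2 α β - lam1 α β ≠ 0 := by
    rw [lam2_sub_lam1]
    exact mul_ne_zero two_ne_zero (root_ne_zero hαβ)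
  have hD : C / (lam2 α β - lam1 α β) * (lam2 α β - lam1 α β) = C := div_mul_cancel₀ _ hsub
  obtain ⟨c, hc⟩ := exists_eq_const_mul hT hne
    (f := fun s => y s - p s - C / (lam2 α β - lam1 α β) * e₂ s) (g := e₁) (z := lam1 α β)
    (fun t ht => by
      have h := (hd1 t ht).sub ((he₂ t ht.1).const_mul (C / (lam2 α β - lam1 α β)))
      convert h using 1
      linear_combination -hC t ht + e₂ t * hD)
    (fun t ht => he₁ t ht.1) he₁0
  exact ⟨c, C / (lam2 α β - lam1 α β), fun t ht => by linear_combination hc t ht⟩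

/-- Delta differentiation shifts the coefficients of a time-scale polynomial. -/
theorem hasDeltaDeriv_sum_hPoly (hT : IsClosed T) {a : ℝ} (ha : a ∈ T) (ht : t ∈ T) (c : ℕ → ℂ)
    {n : ℕ} (hc : c n = 0) :
    HasDeltaDeriv T (fun s => ∑ i ∈ Finset.range n, c i * (hPoly T a i s : ℂ))
      (∑ i ∈ Finset.range n, c (i + 1) * (hPoly T a i t : ℂ)) t := by
  have h1 : ∀ s, ∑ i ∈ Finset.range n, c i * (hPoly T a i s : ℂ)
      = ∑ i ∈ Finset.range n, c (i + 1) * (hPoly T a (i + 1) s : ℂ) + c 0 := by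
    intro s
    have h2 := Finset.sum_range_succ (fun i => c i * (hPoly T a i s : ℂ)) n
    rw [Finset.sum_range_succ', hc, zero_mul, add_zero] at h2
    rw [← h2, hPoly, Complex.ofReal_one, mul_one]
  simp only [h1]
  have h3 := (HasDeltaDeriv.sum (Finset.range n) fun i _ =>
    (hasDeltaDeriv_hPoly_succ hT ha i ht).const_mul (c (i + 1))).add
      (hasDeltaDeriv_const T t (c 0))
  rwa [add_zero] at h3

/-- Exponentials of the characteristic roots together with the time-scale polynomial with
coefficients `ξ_i` solve the equation. -/
theorem isSolution_explicit (hT : IsClosed T) {a : ℝ} (ha : a ∈ T) {α β : ℝ} (hβ : β ≠ 0)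
    (hαβ : β ≠ α ^ 2) (γ : ℕ → ℝ) (k : ℕ) {e₁ e₂ : ℝ → ℂ}
    (he₁ : ∀ t ∈ T, HasDeltaDeriv T e₁ (lam1 α β * e₁ t) t)
    (he₂ : ∀ t ∈ T, HasDeltaDeriv T e₂ (lam2 α β * e₂ t) t) (c₁ c₂ : ℂ) :
    IsSolution T α β (fun t => ∑ i ∈ Finset.range (k + 1), (γ i : ℂ) * (hPoly T a i t : ℂ))
      (fun t => c₁ * e₁ t + c₂ * e₂ t
        + ∑ i ∈ Finset.range (k + 1), xi α β γ k i * (hPoly T a i t : ℂ)) := by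
  have hβ' : (β : ℂ) ≠ 0 := Complex.ofReal_ne_zero.2 hβ
  have hmul := lam1_mul_lam2 α β
  have hadd := lam1_add_lam2 α β
  -- extending the coefficients by zero makes the recursion cover the terminal values as well
  set X : ℕ → ℂ := fun i => if i ≤ k then xi α β γ k i else 0 with hX
  have hX0 : ∀ i, k < i → X i = 0 := fun i hi => if_neg (not_le.2 hi)
  have hX1 : ∀ i, i ≤ k → X i = xi α β γ k i := fun i hi => if_pos hi
  have hrec : ∀ i, i ≤ k → X (i + 2) + 2 * α * X (i + 1) + β * X i = γ i := by
    intro i hi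
    rcases Nat.lt_or_ge (i + 1) k with h | h
    · rw [hX1 _ (by omega), hX1 _ (by omega), hX1 _ hi]
      exact xi_add_two hβ hαβ γ (by omega)
    rcases hi.eq_or_lt with rfl | h'
    · rw [hX0 _ (by omega), hX0 _ (by omega), hX1 _ le_rfl, xi_last, xiLast]
      field_simp
      ring
    · obtain rfl : k = i + 1 := by omega
      rw [hX0 _ (by omega), hX1 _ le_rfl, hX1 _ hi, xi_last, xi_prev, xiLast, xiPrev,
        Nat.add_sub_cancel]
      field_simp
      ring
  have hsum : ∀ t, ∑ i ∈ Finset.range (k + 1), xi α β γ k i * (hPoly T a i t : ℂ)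
      = ∑ i ∈ Finset.range (k + 1), X i * (hPoly T a i t : ℂ) := fun t =>
    Finset.sum_congr rfl fun i hi => by rw [hX1 i (Nat.lt_succ_iff.1 (Finset.mem_range.1 hi))]
  simp only [hsum]
  refine isSolution_of_hasDeltaDeriv hT
    (y₁ := fun t => c₁ * lam1 α β * e₁ t + c₂ * lam2 α β * e₂ t
      + ∑ i ∈ Finset.range (k + 1), X (i + 1) * (hPoly T a i t : ℂ))
    (y₂ := fun t => c₁ * lam1 α β * (lam1 α β * e₁ t) + c₂ * lam2 α β * (lam2 α β * e₂ t)
      + ∑ i ∈ Finset.range (k + 1), X (i + 2) * (hPoly T a i t : ℂ))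
    (fun t ht => ?_) (fun t ht => ?_) ?_ fun t _ => ?_
  · convert (((he₁ t ht).const_mul c₁).add ((he₂ t ht).const_mul c₂)).add
      (hasDeltaDeriv_sum_hPoly hT ha ht X (hX0 _ (Nat.lt_succ_self k))) using 1
    ring
  · exact (((he₁ t ht).const_mul (c₁ * lam1 α β)).add ((he₂ t ht).const_mul (c₂ * lam2 α β))).add
      (hasDeltaDeriv_sum_hPoly hT ha ht (fun i => X (i + 1)) (hX0 _ (by omega)))
  · have k1 : ContinuousOn e₁ T := fun t ht => (he₁ t ht).continuousWithinAt ht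
    have k2 : ContinuousOn e₂ T := fun t ht => (he₂ t ht).continuousWithinAt ht
    have k3 := continuousOn_hPoly hT ha
    fun_prop
  · have hγ : ∑ i ∈ Finset.range (k + 1), (γ i : ℂ) * (hPoly T a i t : ℂ)
        = ∑ i ∈ Finset.range (k + 1), X (i + 2) * (hPoly T a i t : ℂ)
          + 2 * α * ∑ i ∈ Finset.range (k + 1), X (i + 1) * (hPoly T a i t : ℂ)
          + β * ∑ i ∈ Finset.range (k + 1), X i * (hPoly T a i t : ℂ) := by
      rw [Finset.mul_sum, Finset.mul_sum, ← Finset.sum_add_distrib, ← Finset.sum_add_distrib]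
      refine Finset.sum_congr rfl fun i hi => ?_
      rw [← hrec i (Nat.lt_succ_iff.1 (Finset.mem_range.1 hi))]
      ring
    rw [hγ]
    linear_combination (c₁ * lam1 α β * e₁ t + c₂ * lam2 α β * e₂ t) * hadd
      - (c₁ * e₁ t + c₂ * e₂ t) * hmul

end TimeScale

theorem mainTheorem1 (T : Set ℝ) (hT : IsClosed T) (a : ℝ) (ha : a ∈ T) (α β : ℝ)
    (hβ : β ≠ 0) (hαβ : β ≠ α ^ 2)
    (hreg : ∀ t ∈ T, 1 - 2 * α * TimeScale.mu T t + β * TimeScale.mu T t ^ 2 ≠ 0)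
    (k : ℕ) (γ : ℕ → ℝ) :
    -- the complex-valued solutions
    (∀ y : ℝ → ℂ,
      TimeScale.IsSolution T α β
          (fun t => ∑ i ∈ Finset.range (k + 1), (γ i : ℂ) * (TimeScale.hPoly T a i t : ℂ)) y ↔
        ∃ c₁ c₂ : ℂ, ∀ t ∈ T,
          y t = c₁ * TimeScale.tsExp T (TimeScale.lam1 α β) t a
            + c₂ * TimeScale.tsExp T (TimeScale.lam2 α β) t a
            + ∑ i ∈ Finset.range (k + 1),
                TimeScale.xi α β γ k i * (TimeScale.hPoly T a i t : ℂ)) ∧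
    -- the real-valued solutions, for real `λ₁` and `λ₂`
    (β < α ^ 2 → ∀ y : ℝ → ℝ,
      TimeScale.IsSolution T α β
          (fun t => ∑ i ∈ Finset.range (k + 1), (γ i : ℂ) * (TimeScale.hPoly T a i t : ℂ))
          (fun t => (y t : ℂ)) ↔
        ∃ c₁ c₂ : ℝ, ∀ t ∈ T,
          (y t : ℂ) = c₁ * TimeScale.tsExp T (TimeScale.lam1 α β) t a
            + c₂ * TimeScale.tsExp T (TimeScale.lam2 α β) t a
            + ∑ i ∈ Finset.range (k + 1),
                TimeScale.xi α β γ k i * (TimeScale.hPoly T a i t : ℂ)) ∧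
    -- the coefficients are real and solve the difference equation
    (∀ i ≤ k, (TimeScale.xi α β γ k i).im = 0) ∧
    (∀ i, i + 2 ≤ k →
      TimeScale.xi α β γ k (i + 2) + 2 * α * TimeScale.xi α β γ k (i + 1)
        + β * TimeScale.xi α β γ k i = γ i) := by
  have hne : T.Nonempty := ⟨a, ha⟩
  have hprod : ∀ t ∈ T, (1 + TimeScale.lam1 α β * TimeScale.mu T t)
      * (1 + TimeScale.lam2 α β * TimeScale.mu T t) ≠ 0 := by
    intro t ht
    rw [TimeScale.one_add_lam1_mul_mul]
    exact Complex.ofReal_ne_zero.2 (hreg t ht)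
  have he₁ : ∀ t ∈ T, TimeScale.HasDeltaDeriv T
      (fun s => TimeScale.tsExp T (TimeScale.lam1 α β) s a)
      (TimeScale.lam1 α β * TimeScale.tsExp T (TimeScale.lam1 α β) t a) t :=
    fun t ht => TimeScale.hasDeltaDeriv_tsExp hT ha ht (left_ne_zero_of_mul (hprod t ht))
  have he₂ : ∀ t ∈ T, TimeScale.HasDeltaDeriv T
      (fun s => TimeScale.tsExp T (TimeScale.lam2 α β) s a)
      (TimeScale.lam2 α β * TimeScale.tsExp T (TimeScale.lam2 α β) t a) t :=
    fun t ht => TimeScale.hasDeltaDeriv_tsExp hT ha ht (right_ne_zero_of_mul (hprod t ht))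
  have hsol := TimeScale.isSolution_explicit hT ha hβ hαβ γ k he₁ he₂
  have hcomplex : ∀ y : ℝ → ℂ,
      TimeScale.IsSolution T α β
          (fun t => ∑ i ∈ Finset.range (k + 1), (γ i : ℂ) * (TimeScale.hPoly T a i t : ℂ)) y ↔
        ∃ c₁ c₂ : ℂ, ∀ t ∈ T,
          y t = c₁ * TimeScale.tsExp T (TimeScale.lam1 α β) t a
            + c₂ * TimeScale.tsExp T (TimeScale.lam2 α β) t a
            + ∑ i ∈ Finset.range (k + 1),
                TimeScale.xi α β γ k i * (TimeScale.hPoly T a i t : ℂ) := by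
    intro y
    constructor
    · intro hy
      have hp := (hsol 0 0).congr hT
        (x := fun t => ∑ i ∈ Finset.range (k + 1),
          TimeScale.xi α β γ k i * (TimeScale.hPoly T a i t : ℂ)) fun t _ => by simp
      exact TimeScale.exists_eq_add_of_isSolution hT hne hαβ he₁ he₂
        (fun t => TimeScale.tsExp_ne_zero T _ t a) (fun t => TimeScale.tsExp_ne_zero T _ t a) hy hp
    · rintro ⟨c₁, c₂, h⟩
      exact (hsol c₁ c₂).congr hT h
  refine ⟨hcomplex, fun hlt y => ?_, fun i hi => TimeScale.im_xi_eq_zero hβ hαβ γ hi,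
    fun i hi => TimeScale.xi_add_two hβ hαβ γ hi⟩
  rw [hcomplex]
  constructor
  · rintro ⟨c₁, c₂, h⟩
    -- the exponentials and the coefficients are real, so the real parts of `c₁` and `c₂` suffice
    refine ⟨c₁.re, c₂.re, fun t ht => ?_⟩
    have hroot := TimeScale.im_root_eq_zero hlt
    have i1 : (TimeScale.tsExp T (TimeScale.lam1 α β) t a).im = 0 :=
      TimeScale.im_tsExp_eq_zero hT ha (by simp [TimeScale.lam1, hroot])
        (fun s hs => left_ne_zero_of_mul (hprod s hs)) ht
    have i2 : (TimeScale.tsExp T (TimeScale.lam2 α β) t a).im = 0 :=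
      TimeScale.im_tsExp_eq_zero hT ha (by simp [TimeScale.lam2, hroot])
        (fun s hs => right_ne_zero_of_mul (hprod s hs)) ht
    have i3 : (∑ i ∈ Finset.range (k + 1),
        TimeScale.xi α β γ k i * (TimeScale.hPoly T a i t : ℂ)).im = 0 := by
      rw [Complex.im_sum]
      refine Finset.sum_eq_zero fun i hi => ?_
      rw [Complex.im_mul_ofReal,
        TimeScale.im_xi_eq_zero hβ hαβ γ (Nat.lt_succ_iff.1 (Finset.mem_range.1 hi)), zero_mul]
    have hre := congrArg Complex.re (h t ht)
    apply Complex.ext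
    · simp only [Complex.add_re, Complex.mul_re, Complex.ofReal_re, Complex.ofReal_im, i1, i2]
        at hre ⊢
      linarith
    · simp [Complex.add_im, Complex.mul_im, i1, i2, i3]
  · rintro ⟨c₁, c₂, h⟩
    exact ⟨c₁, c₂, h⟩
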